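/- All graphs are finite, simple and undirected. A connected graph $G$ with chromatic number $\chi(G)=k$ is called a \emph{double-critical $k$-chromatic graph} if for every edge $uv$ of $G$ the graph $G-u-v$, obtained by deleting the two vertices $u$ and $v$, is $(k-2)$-colourable. A graph $G$ \emph{contains an $H$ minor} if there is a collection $\{V_h : h\in V(H)\}$ of non-empty, pairwise disjoint subsets of $V(G)$ such that the induced subgraph $G[V_h]$ is connected for each $h\in V(H)$ and, for any two adjacent vertices $h_1,h_2$ of $H$, some edge of $G$ joins a vertex of $V_{h_1}$ to a vertex of $V_{h_2}$. \textbf{Corollary.} Every double-critical $8$-chromatic graph with minimum degree $9$ contains a $K_8$ minor, where $K_8$ denotes the complete graph on $8$ vertices. -/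

import Mathlib

namespace SimpleGraph

/-- `G` is a double-critical `k`-chromatic graph: it is connected, has chromatic number `k`, and
for every edge `uv` the graph `G - u - v` is `(k - 2)`-colourable. (A graph that has an edge has
chromatic number at least `2`, so the subtraction never truncates where it is used.) -/
def IsDoubleCritical {V : Type*} (G : SimpleGraph V) (k : ℕ) : Prop :=
  G.Connected ∧ G.chromaticNumber = k ∧
    ∀ u v : V, G.Adj u v → (G.induce ({u, v}ᶜ : Set V)).Colorable (k - 2)

/-- `H` is a minor of `G`: there are non-empty, pairwise disjoint branch sets `B h ⊆ V(G)`, indexed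
by the vertices `h` of `H`, each inducing a connected subgraph of `G`, such that for any two
adjacent vertices of `H` some edge of `G` joins the corresponding branch sets. -/
def IsMinor {W V : Type*} (H : SimpleGraph W) (G : SimpleGraph V) : Prop :=
  ∃ B : W → Set V,
    (∀ h, (B h).Nonempty) ∧
    (∀ h₁ h₂, h₁ ≠ h₂ → Disjoint (B h₁) (B h₂)) ∧
    (∀ h, (G.induce (B h)).Connected) ∧
    (∀ h₁ h₂, H.Adj h₁ h₂ → ∃ a ∈ B h₁, ∃ b ∈ B h₂, G.Adj a b)

end SimpleGraph

/-! Fix a vertex x of degree 9 and let H be the complement of the graph induced on its closed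
neighbourhood, which has ten vertices. For a neighbour y of x, take a 6-colouring of G - x - y.
Since G is not 7-colourable, every colour occurs on a common neighbour of x and y. Hence a
non-neighbour of y in N(x) has a further non-neighbour there, and counting inside the nine
neighbours leaves each vertex of H with degree 0 or 2. The same colourings exclude triangles and
4-cycles from H. As x is isolated in H, only nine vertices remain, so H is edgeless or a single
cycle of length 5 to 9 plus isolated vertices.

Up to length 8, contracting edges inside the closed neighbourhood already gives the minor. For
length 9, one more adjacency is supplied by a Kempe chain through the rest of G
(`exists_kempe_chain_of_far`). -/

namespace SimpleGraph

/-! ### Complete minors by merging connected sets -/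

section Minor

variable {V ι κ : Type*} {G : SimpleGraph V}

/-- A complete minor obtained by merging connected sets `T i` along stars: the branch set of `c`
is the union of the `T i` with `b i = c`, each of which is joined by an edge to `T (hub c)`. -/
theorem isMinor_top_of_star_merge (T : ι → Set V) (R : ι → ι → Prop)
    (hconn : ∀ i, (G.induce (T i)).Connected)
    (hdisj : ∀ i j, i ≠ j → Disjoint (T i) (T j))
    (hR : ∀ i j, R i j → ∃ a ∈ T i, ∃ c ∈ T j, G.Adj a c)
    (b : ι → κ) (hub : κ → ι) (hb : ∀ c, b (hub c) = c)
    (hstar : ∀ j, j ≠ hub (b j) → R (hub (b j)) j)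
    (hadj : ∀ c d, c ≠ d → ∃ i j, b i = c ∧ b j = d ∧ R i j) :
    (⊤ : SimpleGraph κ).IsMinor G := by
  have hne : ∀ i, (T i).Nonempty := fun i => by
    obtain ⟨a⟩ := (hconn i).nonempty
    exact ⟨a.1, a.2⟩
  refine ⟨fun c => ⋃ i ∈ {i | b i = c}, T i, ?_, ?_, ?_, ?_⟩
  · intro c
    obtain ⟨a, ha⟩ := hne (hub c)
    exact ⟨a, Set.mem_biUnion (hb c) ha⟩
  · intro c d hcd
    simp only [Set.disjoint_iUnion_left, Set.disjoint_iUnion_right]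
    intro i hi j hj
    exact hdisj _ _ (by rintro rfl; exact hcd (hj.symm.trans hi))
  · intro c
    obtain ⟨a, ha⟩ := hne (hub c)
    refine induce_connected_of_patches a (Set.mem_biUnion (hb c) ha) fun {v} hv => ?_
    simp only [Set.mem_iUnion, Set.mem_ofPred_eq, exists_prop] at hv
    obtain ⟨j, rfl, hj⟩ := hv
    by_cases h : j = hub (b j)
    · refine ⟨T j, Set.subset_biUnion_of_mem (u := T) (rfl : b j = b j), h ▸ ha, hj, ?_⟩
      exact (hconn j).preconnected _ _
    · obtain ⟨s, hs, t, ht, hst⟩ := hR _ _ (hstar j h)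
      refine ⟨T (hub (b j)) ∪ T j, Set.union_subset
        (Set.subset_biUnion_of_mem (u := T) (hb (b j)))
        (Set.subset_biUnion_of_mem (u := T) (rfl : b j = b j)), Or.inl ha, Or.inr hj, ?_⟩
      exact (connected_induce_union (hconn _).preconnected (hconn _).preconnected
        hs ht hst).preconnected _ _
  · intro c d hcd
    obtain ⟨i, j, hi, hj, hij⟩ := hadj c d (by simpa using hcd)
    obtain ⟨s, hs, t, ht, hst⟩ := hR _ _ hij
    exact ⟨s, Set.mem_biUnion hi hs, t, Set.mem_biUnion hj ht, hst⟩

end Minor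

/-! ### Colourings of G - x - y and Kempe chains -/

section Colouring

variable {V : Type*} {G : SimpleGraph V} {n : ℕ}

/-- `φ` is a proper colouring of the graph obtained from `G` by deleting `x` and `y`. -/
def IsColouringOff (G : SimpleGraph V) (x y : V) (φ : V → Fin n) : Prop :=
  ∀ u v, u ≠ x → u ≠ y → v ≠ x → v ≠ y → G.Adj u v → φ u ≠ φ v

theorem exists_isColouringOff [NeZero n] {x y : V}
    (h : (G.induce ({x, y}ᶜ : Set V)).Colorable n) :
    ∃ φ : V → Fin n, G.IsColouringOff x y φ := by
  classical
  obtain ⟨c⟩ := h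
  -- The value 0 at x and y is harmless: `IsColouringOff` ignores both.
  refine ⟨fun v => if hv : v ∈ ({x, y}ᶜ : Set V) then c ⟨v, hv⟩ else 0, ?_⟩
  intro u v hux huy hvx hvy huv
  have hu : u ∈ ({x, y}ᶜ : Set V) := by simp [hux, huy]
  have hv : v ∈ ({x, y}ᶜ : Set V) := by simp [hvx, hvy]
  simp only [dif_pos hu, dif_pos hv]
  exact c.valid (by simpa using huv)

/-- If `G` is not `(n + 1)`-colourable, then in any `n`-colouring of `G - x - y` every colour
occurs on a common neighbour of `x` and `y`. -/
theorem IsColouringOff.exists_common_neighbor (hχ : ¬ G.Colorable (n + 1)) {x y : V}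
    {φ : V → Fin n} (hφ : G.IsColouringOff x y φ) (c : Fin n) :
    ∃ v, G.Adj x v ∧ G.Adj y v ∧ φ v = c := by
  classical
  by_contra! hno
  -- x takes colour c; its neighbours of colour c join y in the new colour. They are independent,
  -- and by assumption none is adjacent to y.
  refine hχ ⟨Coloring.mk (fun v => if v = x then c.castSucc else
    if v = y ∨ (G.Adj x v ∧ φ v = c) then Fin.last n else (φ v).castSucc) ?_⟩
  intro u v huv
  have key : ∀ u v, G.Adj u v → u ≠ x → u ≠ y → v ≠ x → v ≠ y → φ u ≠ φ v :=
    fun u v h a b c d => hφ u v a b c d h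
  have hsymm := huv.symm
  have hne := huv.ne
  have hl : ∀ k : Fin n, k.castSucc ≠ Fin.last n := fun k => (Fin.castSucc_lt_last k).ne
  have hl' : ∀ k : Fin n, Fin.last n ≠ k.castSucc := fun k => (Fin.castSucc_lt_last k).ne'
  have hinj : ∀ a b : Fin n, a.castSucc = b.castSucc ↔ a = b := fun a b => Fin.castSucc_inj
  by_cases hu : u = y <;> by_cases hv : v = y <;> split_ifs <;> grind

/-- A non-neighbour `z` of `y` in the neighbourhood of `x` has the colour of a common neighbour
of `x` and `y`. -/
theorem IsColouringOff.exists_nonadj_common_neighbor (hχ : ¬ G.Colorable (n + 1))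
    {x y : V} {φ : V → Fin n} (hφ : G.IsColouringOff x y φ) {z : V} (hxz : G.Adj x z)
    (hyz : y ≠ z ∧ ¬ G.Adj y z) :
    ∃ c, G.Adj x c ∧ G.Adj y c ∧ φ c = φ z ∧ z ≠ c ∧ ¬ G.Adj z c := by
  obtain ⟨c, h1, h2, h3⟩ := hφ.exists_common_neighbor hχ (φ z)
  refine ⟨c, h1, h2, h3, ?_, fun h => ?_⟩
  · rintro rfl
    exact hyz.2 h2
  · exact hφ z c hxz.ne' hyz.1.symm h1.ne' h2.ne' h h3.symm

/-- Two colours that each occur exactly once in the neighbourhood of `x` are joined by a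
Kempe chain. -/
theorem IsColouringOff.exists_kempe_chain (hχ : ¬ G.Colorable (n + 1)) {x y : V}
    {φ : V → Fin n} (hφ : G.IsColouringOff x y φ) {a b : V} (hab : a ≠ b)
    (hay : a ≠ y) (hby : b ≠ y) (hxa : G.Adj x a) (hxb : G.Adj x b)
    (ha : ∀ v, G.Adj x v → v ≠ y → φ v = φ a → v = a)
    (hb : ∀ v, G.Adj x v → v ≠ y → φ v = φ b → v = b) :
    ∃ S : Set V, a ∈ S ∧ (G.induce S).Connected ∧ (∃ s ∈ S, G.Adj s b) ∧
      ∀ v ∈ S, v = x ∨ v = y ∨ G.Adj x v → v = a := by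
  classical
  have hcab : φ a ≠ φ b := fun h => hab (hb a hxa hay h)
  let K : SimpleGraph V := G ⊓ SimpleGraph.fromRel fun u v =>
    (u ≠ x ∧ u ≠ y ∧ (φ u = φ a ∨ φ u = φ b)) ∧ (v ≠ x ∧ v ≠ y ∧ (φ v = φ a ∨ φ v = φ b))
  have hK : ∀ u v, K.Adj u v ↔ G.Adj u v ∧
    (u ≠ x ∧ u ≠ y ∧ (φ u = φ a ∨ φ u = φ b)) ∧ (v ≠ x ∧ v ≠ y ∧ (φ v = φ a ∨ φ v = φ b)) := by
    intro u v
    simp only [K, inf_adj, fromRel_adj]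
    constructor
    · rintro ⟨h, -, h' | h'⟩
      · exact ⟨h, h'⟩
      · exact ⟨h, h'.2, h'.1⟩
    · rintro ⟨h, h'⟩
      exact ⟨h, h.ne, Or.inl h'⟩
  have hgood : ∀ {u w}, K.Walk u w → (w ≠ x ∧ w ≠ y ∧ (φ w = φ a ∨ φ w = φ b)) →
      (u ≠ x ∧ u ≠ y ∧ (φ u = φ a ∨ φ u = φ b)) := by
    intro u w p hw
    cases p with
    | nil => exact hw
    | cons h p => exact ((hK _ _).1 h).2.1
  have haG : a ≠ x ∧ a ≠ y ∧ (φ a = φ a ∨ φ a = φ b) := ⟨hxa.ne', hay, Or.inl rfl⟩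
  have hreach : K.Reachable b a := by
    by_contra hnr
    -- Swapping the two colours on the chain of a, with b outside it, would leave no common
    -- neighbour of x and y with colour `φ a`.
    let ψ : V → Fin n := fun v =>
      if K.Reachable v a then Equiv.swap (φ a) (φ b) (φ v) else φ v
    have hψ : G.IsColouringOff x y ψ := by
      intro u v hux huy hvx hvy huv
      have hne := hφ u v hux huy hvx hvy huv
      have hone : ∀ u v, u ≠ x → u ≠ y → v ≠ x → v ≠ y → G.Adj u v → K.Reachable u a →
          ¬ K.Reachable v a → Equiv.swap (φ a) (φ b) (φ u) ≠ φ v := by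
        intro u v hux huy hvx hvy huv hu hv
        obtain ⟨p⟩ := hu
        have hgu := hgood p haG
        have hnv : ¬ (φ v = φ a ∨ φ v = φ b) := fun h =>
          hv (((hK v u).2 ⟨huv.symm, ⟨hvx, hvy, h⟩, hgu⟩).reachable.trans ⟨p⟩)
        rcases hgu.2.2 with h | h
        · rw [h, Equiv.swap_apply_left]
          exact fun h' => hnv (Or.inr h'.symm)
        · rw [h, Equiv.swap_apply_right]
          exact fun h' => hnv (Or.inl h'.symm)
      dsimp only [ψ]
      split_ifs with h1 h2 h2
      · exact fun h => hne ((Equiv.swap _ _).injective h)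
      · exact hone u v hux huy hvx hvy huv h1 h2
      · exact (hone v u hvx hvy hux huy huv.symm h2 h1).symm
      · exact hne
    obtain ⟨v, hxv, hyv, hv⟩ := hψ.exists_common_neighbor hχ (φ a)
    have hvy : v ≠ y := hyv.ne'
    dsimp only [ψ] at hv
    split_ifs at hv with h
    · have : φ v = φ b := by
        rw [← Equiv.swap_apply_left (φ a) (φ b)]
        exact (Equiv.swap _ _).injective (by rw [hv, Equiv.swap_apply_left, Equiv.swap_apply_right])
      exact hnr (hb v hxv hvy this ▸ h)
    · exact h (ha v hxv hvy hv ▸ Reachable.refl _)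
  obtain ⟨p, hp⟩ := hreach.exists_isPath
  cases p with
  | nil => exact absurd rfl hab
  -- S is the path without its first vertex b, so a is its only vertex in N(x).
  | @cons _ s _ h p =>
    have hle : K ≤ G := inf_le_left
    refine ⟨{v | v ∈ (p.mapLe hle).support}, ?_, (p.mapLe hle).connected_induce_support,
      ⟨s, ?_, ((hK _ _).1 h).1.symm⟩, ?_⟩
    · exact Walk.end_mem_support _
    · exact Walk.start_mem_support _
    · intro v hv hv'
      have hv : v ∈ p.support := by simpa using hv
      have hg := hgood (p.dropUntil v hv) haG
      rw [Walk.cons_isPath_iff] at hp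
      have hvb : v ≠ b := by
        rintro rfl
        exact hp.2 hv
      rcases hv' with h | h | h
      · exact absurd h hg.1
      · exact absurd h hg.2.1
      · rcases hg.2.2 with h' | h'
        · exact ha v h hg.2.1 h'
        · exact absurd (hb v h hg.2.1 h') hvb

end Colouring

/-! ### Graphs with all degrees 0 or 2 and no short cycle -/

section Cycles

variable {W : Type*} {H : SimpleGraph W}

/-- Every non-isolated vertex has exactly two neighbours, and these are non-adjacent and have no
other common neighbour. -/
def IsCyclic (H : SimpleGraph W) : Prop :=
  ∀ y z, H.Adj y z → ∃ z', z' ≠ z ∧ (∀ w, H.Adj y w ↔ w = z ∨ w = z') ∧ ¬ H.Adj z z' ∧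
    ∀ u, H.Adj u z → H.Adj u z' → u = y

/-- Adjacency of the cycle `0, 1, …, m - 1` on the natural numbers. -/
abbrev cycleRel (m i j : ℕ) : Prop :=
  i < m ∧ j < m ∧ ((i + 1) % m = j ∨ (j + 1) % m = i)

/-- A walk that never turns back must repeat a vertex. The last two clauses of `IsCyclic` exclude
lengths 3 and 4. -/
theorem IsCyclic.exists_cycle [Finite W] (hH : H.IsCyclic) {y z : W} (hyz : H.Adj y z) :
    ∃ (m : ℕ) (p : ℕ → W), 5 ≤ m ∧ p 0 = y ∧ Set.InjOn p (Set.Iio m) ∧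
      (∀ i, H.Adj (p i) (p (i + 1))) ∧
      (∀ i < m, ∀ w, H.Adj (p i) w → ∃ j < m, w = p j) ∧
      (∀ i < m, ∀ j < m, H.Adj (p i) (p j) ↔ cycleRel m i j) := by
  classical
  have hnext : ∀ d : H.Dart, ∃ e : H.Dart, e.fst = d.snd ∧ e.snd ≠ d.fst ∧
      ∀ w, H.Adj d.snd w ↔ w = d.fst ∨ w = e.snd := by
    intro d
    obtain ⟨z', h1, h2, -⟩ := hH d.snd d.fst d.adj.symm
    exact ⟨⟨(d.snd, z'), (h2 z').2 (Or.inr rfl)⟩, rfl, h1, h2⟩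
  choose nxt hn1 hn2 hn3 using hnext
  let q : ℕ → H.Dart := fun k => nxt^[k] ⟨(y, z), hyz⟩
  have hq : ∀ k, q (k + 1) = nxt (q k) := fun k => Function.iterate_succ_apply' _ _ _
  let p : ℕ → W := fun k => (q k).fst
  have hsnd : ∀ k, (q k).snd = p (k + 1) := fun k => by
    simp only [p, hq, hn1]
  have hadj : ∀ i, H.Adj (p i) (p (i + 1)) := fun i => by
    rw [← hsnd]; exact (q i).adj
  have hne : ∀ i, p (i + 2) ≠ p i := fun i => by
    have := hn2 (q i)
    rwa [← hq, hsnd] at this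
  have hnb : ∀ i w, H.Adj (p (i + 1)) w ↔ w = p i ∨ w = p (i + 2) := fun i w => by
    have := hn3 (q i) w
    rwa [← hq, hsnd, hsnd] at this
  have hex : ∃ m, ∃ i < m, p m = p i := by
    obtain ⟨i, j, hij, h⟩ := Finite.exists_ne_map_eq_of_infinite p
    rcases lt_or_gt_of_ne hij with h' | h'
    · exact ⟨j, i, h', h.symm⟩
    · exact ⟨i, j, h', h⟩
  obtain ⟨m, ⟨i, him, hmi⟩, hmin⟩ : ∃ m, (∃ i < m, p m = p i) ∧ ∀ k < m, ¬ ∃ i < k, p k = p i :=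
    ⟨Nat.find hex, Nat.find_spec hex, fun k hk => Nat.find_min hex hk⟩
  have hinj : ∀ a < m, ∀ b < m, p a = p b → a = b := by
    intro a ha b hb hab
    by_contra hne
    rcases lt_or_gt_of_ne hne with h | h
    · exact hmin b hb ⟨a, h, hab.symm⟩
    · exact hmin a ha ⟨b, h, hab⟩
  -- A first return to a later vertex would give that vertex a third neighbour.
  have hi0 : i = 0 := by
    by_contra hi
    obtain ⟨i, rfl⟩ := Nat.exists_eq_succ_of_ne_zero hi
    obtain ⟨m, rfl⟩ := Nat.exists_eq_succ_of_ne_zero (by omega : m ≠ 0)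
    have h := (hnb i (p m)).1 (hmi ▸ (hadj m).symm)
    rcases h with h | h
    · have := hinj m (by omega) i (by omega) h
      omega
    · by_cases hm : i + 2 < m + 1
      · have := hinj m (by omega) (i + 2) hm h
        subst this
        exact hne _ hmi
      · have : m = i + 1 := by omega
        subst this
        exact (hadj _).ne h
  subst hi0
  have h1 : m ≠ 1 := by rintro rfl; exact (hadj 0).ne hmi.symm
  have h2 : m ≠ 2 := by rintro rfl; exact hne 0 hmi
  obtain ⟨k, rfl⟩ : ∃ k, m = k + 3 := ⟨m - 3, by omega⟩
  have hlast : H.Adj (p 0) (p (k + 2)) := by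
    rw [← hmi]; exact (hadj _).symm
  obtain ⟨z', hz', hnb0, hna, hcom⟩ := hH _ _ (hadj 0)
  have hz'eq : p (k + 2) = z' := by
    rcases (hnb0 _).1 hlast with h | h
    · have := hinj _ (by omega) _ (by omega) h
      omega
    · exact h
  subst hz'eq
  have h3 : k ≠ 0 := by
    rintro rfl
    exact hna (hadj 1)
  have h4 : k ≠ 1 := by
    rintro rfl
    have := hinj 2 (by omega) 0 (by omega) (hcom (p 2) (hadj 1).symm (hadj 2))
    omega
  have hnbr : ∀ i < k + 3, ∀ w, H.Adj (p i) w ↔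
      w = p ((i + 1) % (k + 3)) ∨ w = p ((i + (k + 2)) % (k + 3)) := by
    intro i hi w
    rcases i with _ | i
    · rw [hnb0, Nat.mod_eq_of_lt (by omega), Nat.mod_eq_of_lt (by omega)]
      simp
    · rw [hnb]
      have e1 : (i + 1 + (k + 2)) % (k + 3) = i := by
        rw [show i + 1 + (k + 2) = i + (k + 3) by ring, Nat.add_mod_right]
        exact Nat.mod_eq_of_lt (by omega)
      rw [e1, or_comm]
      by_cases h : i + 2 < k + 3
      · rw [Nat.mod_eq_of_lt (a := i + 1 + 1) (by omega)]
      · have : i = k + 1 := by omega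
        subst this
        rw [Nat.mod_self]
        rw [show k + 1 + 2 = k + 3 by ring, hmi]
  have hmod : ∀ t, t % (k + 3) < k + 3 := fun t => Nat.mod_lt _ (by omega)
  refine ⟨k + 3, p, by omega, rfl, fun a ha b hb => hinj a ha b hb, hadj, ?_, ?_⟩
  · intro i hi w hw
    rcases (hnbr i hi w).1 hw with h | h
    · exact ⟨_, hmod _, h⟩
    · exact ⟨_, hmod _, h⟩
  · intro i hi j hj
    rw [hnbr i hi]
    have e1 : p j = p ((i + 1) % (k + 3)) ↔ (i + 1) % (k + 3) = j :=
      ⟨fun h => (hinj _ hj _ (hmod _) h).symm, fun h => by rw [h]⟩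
    have e2 : p j = p ((i + (k + 2)) % (k + 3)) ↔ (j + 1) % (k + 3) = i := by
      constructor
      · intro h
        have := hinj _ hj _ (hmod _) h
        rw [this, Nat.mod_add_mod, show i + (k + 2) + 1 = i + (k + 3) by ring, Nat.add_mod_right]
        exact Nat.mod_eq_of_lt hi
      · intro h
        rw [← h, Nat.mod_add_mod, show j + 1 + (k + 2) = j + (k + 3) by ring, Nat.add_mod_right,
          Nat.mod_eq_of_lt hj]
    rw [e1, e2]
    simp [cycleRel, hi, hj]

/-- Two disjoint cycles and the isolated vertex o would need 5 + 5 + 1 vertices. The value m = 0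
encodes the edgeless graph. -/
theorem IsCyclic.exists_equiv_fin [Fintype W] (hcard : Fintype.card W = 10) (hH : H.IsCyclic)
    (o : W) (ho : ∀ w, ¬ H.Adj o w) :
    ∃ m, (m = 0 ∨ 5 ≤ m) ∧ m ≤ 9 ∧ ∃ e : Fin 10 ≃ W,
      ∀ i j, H.Adj (e i) (e j) ↔ cycleRel m i j := by
  classical
  by_cases hbot : ∃ y z, H.Adj y z
  swap
  · push Not at hbot
    refine ⟨0, Or.inl rfl, by omega, (Fintype.equivFinOfCardEq hcard).symm, fun i j => ?_⟩
    simp [hbot, cycleRel]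
  obtain ⟨y, z, hyz⟩ := hbot
  obtain ⟨m, p, hm5, -, hinj, hadj, hclosed, hrel⟩ := hH.exists_cycle hyz
  have hpo : ∀ q : ℕ → W, (∀ i, H.Adj (q i) (q (i + 1))) → ∀ i, q i ≠ o := fun q hq i h =>
    ho (q (i + 1)) (h ▸ hq i)
  let A := (Finset.range m).image p
  have hA : A.card = m := by
    rw [Finset.card_image_of_injOn (by simpa using! hinj), Finset.card_range]
  have hoA : o ∉ A := by
    simp only [A, Finset.mem_image, not_exists, not_and]
    exact fun i _ => hpo p hadj i
  have hrest : ∀ w ∉ A, ∀ u, ¬ H.Adj w u := by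
    intro w hw u hwu
    obtain ⟨m', p', hm', h0, hinj', hadj', -, -⟩ := hH.exists_cycle hwu
    have hout : ∀ i, p' i ∉ A := by
      intro i
      induction i with
      | zero => rwa [h0]
      | succ i ih =>
        intro h
        simp only [A, Finset.mem_image, Finset.mem_range] at h ih
        obtain ⟨j, hj, hj'⟩ := h
        obtain ⟨t, ht, ht'⟩ := hclosed j hj (p' i) (hj' ▸ (hadj' i).symm)
        exact ih ⟨t, ht, ht'.symm⟩
    let B := (Finset.range m').image p'
    have hB : B.card = m' := by
      rw [Finset.card_image_of_injOn (by simpa using! hinj'), Finset.card_range]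
    have hAB : Disjoint A B := by
      rw [Finset.disjoint_right]
      intro v hv
      obtain ⟨i, -, rfl⟩ := Finset.mem_image.1 hv
      exact hout i
    have hoAB : o ∉ A ∪ B := by
      simp only [Finset.mem_union, not_or]
      refine ⟨hoA, ?_⟩
      simp only [B, Finset.mem_image, not_exists, not_and]
      exact fun i _ => hpo p' hadj' i
    have := Finset.card_le_univ (insert o (A ∪ B))
    rw [Finset.card_insert_of_notMem hoAB, Finset.card_union_of_disjoint hAB, hA, hB, hcard] at this
    omega
  have hm9 : m ≤ 9 := by
    have := Finset.card_le_univ (insert o A)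
    rw [Finset.card_insert_of_notMem hoA, hA, hcard] at this
    omega
  obtain ⟨g, hg⟩ := Finset.exists_equiv_extend_of_card_eq (α := Fin 10) (t := Finset.univ)
    (by rw [Finset.card_univ, hcard, Fintype.card_fin])
    (s := Finset.univ.filter fun i : Fin 10 => i.val < m) (f := fun i => p i)
    (Finset.subset_univ _) (by
      intro a ha b hb hab
      simp only [Finset.coe_filter, Finset.mem_univ, true_and, Set.mem_ofPred_eq] at ha hb
      exact Fin.ext (hinj ha hb hab))
  let e : Fin 10 ≃ W := g.trans (Equiv.subtypeUnivEquiv fun w => Finset.mem_univ w)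
  have he : ∀ i : Fin 10, i.val < m → e i = p i := fun i hi => hg i (by simpa using hi)
  have heA : ∀ i : Fin 10, ¬ i.val < m → e i ∉ A := by
    intro i hi h
    simp only [A, Finset.mem_image, Finset.mem_range] at h
    obtain ⟨j, hj, hj'⟩ := h
    have := he ⟨j, by omega⟩ hj
    rw [hj'] at this
    have := congrArg Fin.val (e.injective this)
    simp only at this
    omega
  refine ⟨m, Or.inr hm5, hm9, e, fun i j => ?_⟩
  by_cases hi : i.val < m
  · by_cases hj : j.val < m
    · rw [he i hi, he j hj]
      exact hrel i hi j hj
    · exact iff_of_false (fun h => hrest _ (heA j hj) _ h.symm) fun h => hj h.2.1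
  · exact iff_of_false (hrest _ (heA i hi) _) fun h => hi h.1

end Cycles

/-! ### The complement of the closed neighbourhood -/

section CoNeighborhood

variable {V : Type*} {G : SimpleGraph V} {x : V}

/-- The complement of the subgraph induced by the closed neighbourhood of `x`. -/
def coNeighborhood (G : SimpleGraph V) (x : V) : SimpleGraph {v // v = x ∨ G.Adj x v} :=
  (G.comap Subtype.val)ᶜ

theorem coNeighborhood_adj {u v : {v // v = x ∨ G.Adj x v}} :
    (G.coNeighborhood x).Adj u v ↔ u.1 ≠ v.1 ∧ ¬ G.Adj u.1 v.1 := by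
  simp [coNeighborhood, Subtype.ext_iff]

theorem adj_of_coNeighborhood_adj {u v : {v // v = x ∨ G.Adj x v}}
    (h : (G.coNeighborhood x).Adj u v) : G.Adj x u.1 ∧ G.Adj x v.1 := by
  rw [coNeighborhood_adj] at h
  obtain ⟨u, hu⟩ := u
  obtain ⟨v, hv⟩ := v
  simp only at h ⊢
  rcases hu with rfl | hu
  · rcases hv with rfl | hv
    · exact absurd rfl h.1
    · exact absurd hv h.2
  · rcases hv with rfl | hv
    · exact absurd hu.symm h.2
    · exact ⟨hu, hv⟩

end CoNeighborhood

/-! ### Degree n + 3 forces cycles in the complement -/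

section Neighbourhood

variable {V : Type*} [Fintype V] {G : SimpleGraph V} [DecidableRel G.Adj] {n : ℕ} {x y : V}

/-- Suppose `x` has degree `n + 3`. If a neighbour `y` of `x` has two non-neighbours `z`, `z'` in
the neighbourhood of `x`, then it has no others, and an `n`-colouring of `G - x - y` is injective
on the common neighbours of `x` and `y`. -/
theorem IsColouringOff.nonadj_eq_or_eq_and_injOn (hχ : ¬ G.Colorable (n + 1))
    (hdeg : G.degree x = n + 3) (hxy : G.Adj x y) {φ : V → Fin n} (hφ : G.IsColouringOff x y φ)
    {z z' : V} (hzz' : z ≠ z') (hxz : G.Adj x z) (hxz' : G.Adj x z') (hyz : y ≠ z ∧ ¬ G.Adj y z)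
    (hyz' : y ≠ z' ∧ ¬ G.Adj y z') :
    (∀ w, G.Adj x w → y ≠ w → ¬ G.Adj y w → w = z ∨ w = z') ∧
      ∀ u v, G.Adj x u → G.Adj y u → G.Adj x v → G.Adj y v → φ u = φ v → u = v := by
  classical
  let C := (G.neighborFinset x).filter fun v => G.Adj y v
  have hmemC : ∀ v, v ∈ C ↔ G.Adj x v ∧ G.Adj y v := fun v => by simp [C]
  have himg : C.image φ = Finset.univ := by
    refine Finset.eq_univ_of_forall fun c => ?_
    obtain ⟨v, h1, h2, h3⟩ := hφ.exists_common_neighbor hχ c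
    exact Finset.mem_image.2 ⟨v, (hmemC v).2 ⟨h1, h2⟩, h3⟩
  have hCn : n ≤ C.card := by
    have := Finset.card_image_le (s := C) (f := φ)
    rwa [himg, Finset.card_univ, Fintype.card_fin] at this
  -- The common neighbours number at least n, so with y, z, z' they exhaust N(x), and n colours on n
  -- vertices give injectivity.
  let D := insert y (insert z (insert z' C))
  have hDcard : D.card = C.card + 3 := by
    rw [Finset.card_insert_of_notMem, Finset.card_insert_of_notMem, Finset.card_insert_of_notMem]
    · simp [hmemC, hyz'.2]
    · simp [hmemC, hyz.2, hzz']
    · simp [hmemC, hyz.1, hyz'.1]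
  have hDsub : D ⊆ G.neighborFinset x := by
    intro v hv
    simp only [D, Finset.mem_insert, hmemC] at hv
    rw [mem_neighborFinset]
    rcases hv with rfl | rfl | rfl | hv
    exacts [hxy, hxz, hxz', hv.1]
  have hDeq : D = G.neighborFinset x := by
    refine Finset.eq_of_subset_of_card_le hDsub ?_
    rw [card_neighborFinset_eq_degree, hdeg, hDcard]
    omega
  have hC : C.card = n := by
    have : D.card = n + 3 := by rw [hDeq, card_neighborFinset_eq_degree, hdeg]
    omega
  constructor
  · intro w hxw hyw hnw
    have : w ∈ D := by rwa [hDeq, mem_neighborFinset]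
    simp only [D, Finset.mem_insert, hmemC] at this
    rcases this with h | h | h | h
    exacts [absurd h.symm hyw, Or.inl h, Or.inr h, absurd h.2 hnw]
  · intro u v h1 h2 h3 h4 h
    have hinj : Set.InjOn φ C := by
      rw [← Finset.card_image_iff, himg, Finset.card_univ, Fintype.card_fin, hC]
    exact hinj (by simp [hmemC, h1, h2]) (by simp [hmemC, h3, h4]) h

theorem isCyclic_coNeighborhood (hχ : ¬ G.Colorable (n + 1)) (hdeg : G.degree x = n + 3)
    (hcol : ∀ y, G.Adj x y → ∃ φ : V → Fin n, G.IsColouringOff x y φ) :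
    (G.coNeighborhood x).IsCyclic := by
  have hother : ∀ y z, G.Adj x y → G.Adj x z → y ≠ z → ¬ G.Adj y z →
      ∃ c, G.Adj x c ∧ G.Adj z c ∧ c ≠ z ∧ y ≠ c ∧ ¬ G.Adj y c := by
    intro y z hy hz hne hyz
    -- Deleting z rather than y makes the second non-neighbour c of y adjacent to z, which rules out
    -- triangles in the complement.
    obtain ⟨φ, hφ⟩ := hcol z hz
    obtain ⟨c, h1, h2, -, h4, h5⟩ := hφ.exists_nonadj_common_neighbor hχ hy
      ⟨hne.symm, fun h => hyz h.symm⟩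
    exact ⟨c, h1, h2, h2.ne', h4, h5⟩
  have huniq : ∀ y z z', G.Adj x y → G.Adj x z → G.Adj x z' → z ≠ z' → y ≠ z ∧ ¬ G.Adj y z →
      y ≠ z' ∧ ¬ G.Adj y z' → ∀ w, G.Adj x w → y ≠ w → ¬ G.Adj y w → w = z ∨ w = z' := by
    intro y z z' hy hz hz' hzz' h h'
    obtain ⟨φ, hφ⟩ := hcol y hy
    exact (hφ.nonadj_eq_or_eq_and_injOn hχ hdeg hy hzz' hz hz' h h').1
  intro y z hyz
  obtain ⟨hxy, hxz⟩ := adj_of_coNeighborhood_adj hyz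
  rw [coNeighborhood_adj] at hyz
  obtain ⟨z', hxz', hzz', hne, hyz'⟩ := hother y z hxy hxz hyz.1 hyz.2
  refine ⟨⟨z', Or.inr hxz'⟩, fun h => hne (congrArg Subtype.val h), fun w => ⟨fun hw => ?_, ?_⟩,
    fun h => (coNeighborhood_adj.1 h).2 hzz', fun u huz huz' => ?_⟩
  · have hxw := (adj_of_coNeighborhood_adj hw).2
    rw [coNeighborhood_adj] at hw
    simpa only [Subtype.ext_iff] using
      huniq y z z' hxy hxz hxz' hne.symm hyz ⟨hyz'.1, hyz'.2⟩ w hxw hw.1 hw.2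
  · rintro (rfl | rfl)
    · exact coNeighborhood_adj.2 hyz
    · exact coNeighborhood_adj.2 hyz'
  · by_contra huy
    have hxu := (adj_of_coNeighborhood_adj huz).1
    have huy' : y.1 ≠ u.1 := fun h => huy (Subtype.ext h.symm)
    rw [coNeighborhood_adj] at huz huz'
    have hsw : ∀ {a b : V}, a ≠ b ∧ ¬ G.Adj a b → b ≠ a ∧ ¬ G.Adj b a :=
      fun h => ⟨h.1.symm, fun h' => h.2 h'.symm⟩
    obtain ⟨φ, hφ⟩ := hcol y hxy
    -- The only non-neighbours of t in N(x) are y and u, so the vertex repeating its colour is u.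
    -- Then the adjacent z and z' would share a colour.
    have hcolour : ∀ t : V, G.Adj x t → y.1 ≠ t ∧ ¬ G.Adj y.1 t → u.1 ≠ t ∧ ¬ G.Adj u.1 t →
        φ u = φ t := by
      intro t hxt hyt hut
      obtain ⟨c, h1, h2, h3, h4, h5⟩ := hφ.exists_nonadj_common_neighbor hχ hxt hyt
      rcases huniq t y u hxt hxy hxu huy' (hsw hyt) (hsw hut) c h1 h4 h5 with h | h
      · exact absurd h h2.ne'
      · rw [← h, h3]
    exact hφ z z' hxz.ne' hyz.1.symm hxz'.ne' hyz'.1.symm hzz'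
      ((hcolour z hxz hyz huz).symm.trans (hcolour z' hxz' hyz' huz'))

/-- Let `y` be a neighbour of `x` with two non-neighbours in the neighbourhood of `x`. Two
vertices at distance more than two from `y` in the complement of the neighbourhood of `x` are
joined by a Kempe chain that avoids the rest of the closed neighbourhood. -/
theorem exists_kempe_chain_of_far (hχ : ¬ G.Colorable (n + 1)) (hdeg : G.degree x = n + 3)
    (hcol : ∀ y, G.Adj x y → ∃ φ : V → Fin n, G.IsColouringOff x y φ)
    {y z z' a b : {v // v = x ∨ G.Adj x v}} (hzz' : z ≠ z')
    (hyz : (G.coNeighborhood x).Adj y z) (hyz' : (G.coNeighborhood x).Adj y z')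
    (hab : (G.coNeighborhood x).Adj a b)
    (ha : a ≠ y ∧ a ≠ z ∧ a ≠ z' ∧ ¬ (G.coNeighborhood x).Adj z a ∧ ¬ (G.coNeighborhood x).Adj z' a)
    (hb : b ≠ y ∧ b ≠ z ∧ b ≠ z' ∧
      ¬ (G.coNeighborhood x).Adj z b ∧ ¬ (G.coNeighborhood x).Adj z' b) :
    ∃ S : Set V, a.1 ∈ S ∧ (G.induce S).Connected ∧ (∃ s ∈ S, G.Adj s b.1) ∧
      ∀ v : {v // v = x ∨ G.Adj x v}, v.1 ∈ S → v = a := by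
  obtain ⟨hxy, hxz⟩ := adj_of_coNeighborhood_adj hyz
  have hxz' := (adj_of_coNeighborhood_adj hyz').2
  obtain ⟨hxa, hxb⟩ := adj_of_coNeighborhood_adj hab
  rw [coNeighborhood_adj] at hyz hyz' hab
  obtain ⟨φ, hφ⟩ := hcol y hxy
  have hne : z.1 ≠ z'.1 := fun h => hzz' (Subtype.ext h)
  obtain ⟨huniq, hinj⟩ := hφ.nonadj_eq_or_eq_and_injOn hχ hdeg hxy hne hxz hxz' hyz hyz'
  -- Outside the common neighbours only z and z' are coloured, and each repeats the colour of a
  -- common neighbour not adjacent to it, hence not of a.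
  have key : ∀ a : {v // v = x ∨ G.Adj x v}, G.Adj x a →
      (a ≠ y ∧ a ≠ z ∧ a ≠ z' ∧ ¬ (G.coNeighborhood x).Adj z a ∧
        ¬ (G.coNeighborhood x).Adj z' a) →
      ∀ v, G.Adj x v → v ≠ y → φ v = φ a → v = a := by
    rintro a hxa ⟨h1, h2, h3, h4, h5⟩ v hxv hvy hv
    have hya : G.Adj y a := by
      by_contra h
      rcases huniq a hxa (fun h => h1 (Subtype.ext h.symm)) h with h | h
      · exact h2 (Subtype.ext h)
      · exact h3 (Subtype.ext h)
    by_cases hyv : G.Adj y v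
    · exact hinj v a hxv hyv hxa hya hv
    · exfalso
      obtain ⟨c, k1, k2, k3, k4, k5⟩ :=
        hφ.exists_nonadj_common_neighbor hχ hxv ⟨hvy.symm, hyv⟩
      have hca := hinj c a k1 k2 hxa hya (k3.trans hv)
      rcases huniq v hxv hvy.symm hyv with rfl | rfl
      · exact h4 (coNeighborhood_adj.2 (hca ▸ ⟨k4, k5⟩))
      · exact h5 (coNeighborhood_adj.2 (hca ▸ ⟨k4, k5⟩))
  obtain ⟨S, h1, h2, h3, h4⟩ := hφ.exists_kempe_chain hχ hab.1
    (fun h => ha.1 (Subtype.ext h)) (fun h => hb.1 (Subtype.ext h)) hxa hxb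
    (key a hxa ha) (key b hxb hb)
  exact ⟨S, h1, h2, h3, fun v hv => Subtype.ext (h4 v hv (v.2.imp id Or.inr))⟩

end Neighbourhood

/-! ### The minor read off from the cycle length -/

section Merge

variable {V : Type*} {G : SimpleGraph V}

theorem isMinor_top_of_injective {m : ℕ} {f : Fin 10 → V} (hf : Function.Injective f)
    (hadj : ∀ i j : Fin 10, i ≠ j → ¬ cycleRel m i j → G.Adj (f i) (f j))
    (b : Fin 10 → Fin 8) (hub : Fin 8 → Fin 10) (hb : ∀ c, b (hub c) = c)
    (hstar : ∀ j, j ≠ hub (b j) → ¬ cycleRel m (hub (b j)) j)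
    (hjoin : ∀ c d, c ≠ d → ∃ i j, b i = c ∧ b j = d ∧ ¬ cycleRel m i j) :
    (⊤ : SimpleGraph (Fin 8)).IsMinor G := by
  refine isMinor_top_of_star_merge (fun i => {f i}) (fun i j => i ≠ j ∧ ¬ cycleRel m i j)
    (fun i => by simp) ?_ ?_ b hub hb (fun j hj => ⟨hj.symm, hstar j hj⟩) ?_
  · intro i j hij
    simpa using hf.ne hij
  · rintro i j ⟨hij, h⟩
    exact ⟨_, rfl, _, rfl, hadj i j hij h⟩
  · intro c d hcd
    obtain ⟨i, j, hi, hj, h⟩ := hjoin c d hcd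
    exact ⟨i, j, hi, hj, by rintro rfl; exact hcd (hi.symm.trans hj), h⟩

theorem isMinor_top_of_cycleRel_nine {f : Fin 10 → V} (hf : Function.Injective f)
    (hadj : ∀ i j : Fin 10, i ≠ j → ¬ cycleRel 9 i j → G.Adj (f i) (f j))
    {S : Set V} (hS3 : f 3 ∈ S) (hS : (G.induce S).Connected) (hS4 : ∃ s ∈ S, G.Adj s (f 4))
    (hfS : ∀ i, f i ∈ S → i = 3) :
    (⊤ : SimpleGraph (Fin 8)).IsMinor G := by
  let T : Fin 10 → Set V := fun i => if i = 3 then S else {f i}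
  have hT3 : T 3 = S := if_pos rfl
  have hT : ∀ i, i ≠ 3 → T i = {f i} := fun i hi => if_neg hi
  have hfT : ∀ i, f i ∈ T i := by
    intro i
    by_cases hi : i = 3
    · subst hi; rwa [hT3]
    · rw [hT i hi]; rfl
  refine isMinor_top_of_star_merge T
    (fun i j => i ≠ j ∧ (¬ cycleRel 9 i j ∨ (i = 3 ∧ j = 4) ∨ (i = 4 ∧ j = 3))) ?_ ?_ ?_
    -- Bags {0,5} and {2,7}, the rest singletons: 3, 4 is the only pair of bags unjoined in the
    -- complement of the 9-cycle, and S joins it.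
    ![0, 1, 2, 3, 4, 0, 5, 2, 6, 7] ![0, 1, 2, 3, 4, 6, 8, 9] (by decide) (by decide) (by decide)
  · intro i
    by_cases hi : i = 3
    · subst hi; rwa [hT3]
    · rw [hT i hi]; simp
  · intro i j hij
    by_cases hi : i = 3
    · subst hi
      rw [hT3, hT j hij.symm, Set.disjoint_singleton_right]
      exact fun h => hij (hfS j h).symm
    · by_cases hj : j = 3
      · subst hj
        rw [hT3, hT i hi, Set.disjoint_singleton_left]
        exact fun h => hi (hfS i h)
      · rw [hT i hi, hT j hj]
        simpa using hf.ne hij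
  · rintro i j ⟨hij, h | ⟨rfl, rfl⟩ | ⟨rfl, rfl⟩⟩
    · exact ⟨_, hfT i, _, hfT j, hadj i j hij h⟩
    · obtain ⟨s, hs, hs4⟩ := hS4
      exact ⟨s, hT3 ▸ hs, _, hfT 4, hs4⟩
    · obtain ⟨s, hs, hs4⟩ := hS4
      exact ⟨_, hfT 4, s, hT3 ▸ hs, hs4.symm⟩

end Merge

end SimpleGraph

open SimpleGraph in
theorem mainTheorem4 {V : Type*} [Fintype V] (G : SimpleGraph V) [DecidableRel G.Adj]
    (hG : G.IsDoubleCritical 8) (hδ : G.minDegree = 9) :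
    (⊤ : SimpleGraph (Fin 8)).IsMinor G := by
  classical
  obtain ⟨hconn, hχ, hcrit⟩ := hG
  have := hconn.nonempty
  obtain ⟨x, hx⟩ := G.exists_minimal_degree_vertex
  have hdeg : G.degree x = 6 + 3 := by rw [← hx, hδ]
  have hχ' : ¬ G.Colorable (6 + 1) := by
    intro h
    have := h.chromaticNumber_le
    rw [hχ] at this
    exact absurd this (by decide)
  have hcol : ∀ y, G.Adj x y → ∃ φ : V → Fin 6, G.IsColouringOff x y φ :=
    fun y hy => exists_isColouringOff (hcrit x y hy)
  have hcard : Fintype.card {v // v = x ∨ G.Adj x v} = 10 := by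
    rw [Fintype.card_subtype]
    have : (Finset.univ.filter fun v => v = x ∨ G.Adj x v) = insert x (G.neighborFinset x) := by
      ext v; simp
    rw [this, Finset.card_insert_of_notMem (by simp), card_neighborFinset_eq_degree, hdeg]
  obtain ⟨m, hm, hm9, e, he⟩ := (isCyclic_coNeighborhood hχ' hdeg hcol).exists_equiv_fin hcard
    ⟨x, Or.inl rfl⟩ (fun w hw => G.irrefl (adj_of_coNeighborhood_adj hw).1)
  have hf : Function.Injective fun i => (e i).1 := Subtype.val_injective.comp e.injective
  have hadj : ∀ i j : Fin 10, i ≠ j → ¬ cycleRel m i j → G.Adj (e i).1 (e j).1 := by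
    intro i j hij h
    rw [← he, coNeighborhood_adj] at h
    by_contra h'
    exact h ⟨hf.ne hij, h'⟩
  obtain rfl | rfl | rfl | rfl | rfl | rfl :
      m = 0 ∨ m = 5 ∨ m = 6 ∨ m = 7 ∨ m = 8 ∨ m = 9 := by omega
  · exact isMinor_top_of_injective hf hadj
      ![0, 1, 2, 3, 4, 5, 6, 7, 7, 7] ![0, 1, 2, 3, 4, 5, 6, 7] (by decide) (by decide) (by decide)
  · exact isMinor_top_of_injective hf hadj
      ![0, 1, 2, 1, 2, 3, 4, 5, 6, 7] ![0, 1, 2, 5, 6, 7, 8, 9] (by decide) (by decide) (by decide)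
  · exact isMinor_top_of_injective hf hadj
      ![0, 1, 2, 1, 3, 1, 4, 5, 6, 7] ![0, 1, 2, 4, 6, 7, 8, 9] (by decide) (by decide) (by decide)
  · exact isMinor_top_of_injective hf hadj
      ![0, 1, 2, 3, 4, 1, 3, 5, 6, 7] ![0, 1, 2, 3, 4, 7, 8, 9] (by decide) (by decide) (by decide)
  · exact isMinor_top_of_injective hf hadj
      ![0, 1, 2, 3, 4, 1, 5, 3, 6, 7] ![0, 1, 2, 3, 4, 6, 8, 9] (by decide) (by decide) (by decide)
  -- On the 9-cycle, 0 has neighbours 1 and 8, and the consecutive vertices 3 and 4 lie at distance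
  -- more than two from 0.
  · obtain ⟨S, h3, hS, h4, hfS⟩ := exists_kempe_chain_of_far hχ' hdeg hcol (y := e 0) (z := e 1)
      (z' := e 8) (a := e 3) (b := e 4) (e.injective.ne (by decide)) ((he _ _).2 (by decide))
      ((he _ _).2 (by decide)) ((he _ _).2 (by decide))
      (by simp only [he, ne_eq, e.injective.eq_iff]; decide)
      (by simp only [he, ne_eq, e.injective.eq_iff]; decide)
    exact isMinor_top_of_cycleRel_nine hf hadj h3 hS h4 fun i hi => e.injective (hfS _ hi)
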